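/- Let $\kappa>0$, and let $\phi_{\boldsymbol\theta}(\alpha^2,\omega)\ge 0$ be a probability density on $(0,\infty)\times\mathbb R$ (with respect to $d\alpha^2\,d\omega$) that is even in the frequency, $\phi_{\boldsymbol\theta}(\alpha^2,-\omega)=\phi_{\boldsymbol\theta}(\alpha^2,\omega)$. Let the pairs $(\alpha_i^2,\omega_i)\sim\phi_{\boldsymbol\theta}$, $i\ge 1$, and the pairs $(s_{i1},s_{i2})$, $i\ge1$, be all mutually independent, where $(s_{i1},s_{i2})$ has the von Mises distribution on the unit circle with mean direction $\mathbf m=\mathbf 1_2/\sqrt2$ and concentration $\kappa$, i.e. density $\frac{1}{2\pi\mathcal I_0(\kappa)}e^{\kappa\,\mathbf m^\top\mathbf s}$ with respect to arc length; $\mathcal I_n$ is the modified Bessel function of the first kind of order $n$, and $r_1=\mathcal I_1(\kappa)/\mathcal I_0(\kappa)$. The impulse response of the concatenation of $n_c$ one-dimensional quantum harmonic oscillators with these parameters is $$\tilde h(t)=\tilde h_{n_c}(t)=\sum_{i=1}^{n_c}\Big(\alpha_i^2e^{-\frac{\alpha_i^2t}{2}}\big(-s_{i1}\cos(\omega_it)+s_{i2}\sin(\omega_it)\big)+s_{i1}\,\delta(t)\Big),$$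 where the Dirac term $\delta(t)$ contributes nothing for $t>0$; by its value at $t=0$ we mean that of the sum without the Dirac term. Put $$\mu_h(t)=-\frac{r_1}{\sqrt2}\int_{-\infty}^{\infty}\int_0^\infty \alpha^2e^{-\frac{\alpha^2t}{2}}\cos(\omega t)\,\phi_{\boldsymbol\theta}(\alpha^2,\omega)\,d\alpha^2\,d\omega,$$ $$K_{\boldsymbol\theta}(t,t')=\frac12\int_{-\infty}^{\infty}\int_0^\infty \alpha^4e^{-\frac{\alpha^2(t+t')}{2}}\cos(\omega(t-t'))\,\phi_{\boldsymbol\theta}(\alpha^2,\omega)\,d\alpha^2\,d\omega-\mu_h(t)\mu_h(t').$$ 1. As $n_c\to\infty$, $$\sqrt{n_c}\Big(\frac1{n_c}\tilde h_{n_c}(t)-\mu_h(t)\Big)\stackrel{d}{\longrightarrow}\mathcal{GP}\big(0,K_{\boldsymbol\theta}(t,t')\big)$$ as processes on the time set $t>0$: a centred Gaussian process with covariance function $K_{\boldsymbol\theta}$ exists, and the joint distribution at any finitely many times converges weakly to that of this process. If moreover $\int\!\!\int\alpha^4\phi_{\boldsymbol\theta}(\alpha^2,\omega)\,d\alpha^2\,d\omega<\infty$,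 the same holds on the time set $t\ge0$. 2. If $\phi_{\boldsymbol\theta}(\alpha^2,\omega)=\frac{\alpha^2/2}{\pi(\omega^2+\alpha^4/4)}\,\mathrm{Unif}(\alpha^2;a_m,a_M)$, where $0<a_m<a_M$ and $\mathrm{Unif}(\cdot\,;a_m,a_M)$ is the density of the uniform distribution on $[a_m,a_M]$, then for $t>0$ $$\mu_h(t)=-\frac{r_1}{\sqrt2}\,\frac{(1+a_mt)e^{-a_mt}-e^{-a_Mt}(1+a_Mt)}{t^2(a_M-a_m)},$$ and for $t,t'\ge0$ with $\tau=\max(t,t')>0$ $$K_{\boldsymbol\theta}(t,t')=\frac12\cdot\frac{2\big[(1+a_m\tau+\frac{a_m^2\tau^2}{2})e^{-a_m\tau}-e^{-a_M\tau}(1+a_M\tau+\frac{a_M^2\tau^2}{2})\big]}{\tau^3(a_M-a_m)}-\mu_h(t)\mu_h(t').$$ -/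

import Mathlib

open MeasureTheory ProbabilityTheory Filter Topology

noncomputable section

namespace QWiener

/-- The modified Bessel function of the first kind `I_n(x)` of integer order `n ≥ 0`. -/
def besselI (n : ℕ) (x : ℝ) : ℝ :=
  ∑' m : ℕ, (x / 2) ^ (2 * m + n) / ((m.factorial : ℝ) * ((m + n).factorial : ℝ))

/-- The ratio `r_1 = I_1(κ) / I_0(κ)`. -/
def r₁ (κ : ℝ) : ℝ := besselI 1 κ / besselI 0 κ

/-- The von Mises(-Fisher) distribution on the unit circle of `ℝ²` with mean direction `m` and
concentration `κ`: density `exp (κ m·s) / (2π I_0(κ))` with respect to arc length, which is the image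
of Lebesgue measure on `(-π, π]` under `θ ↦ (cos θ, sin θ)`. -/
def vonMises (m : ℝ × ℝ) (κ : ℝ) : Measure (ℝ × ℝ) :=
  ((volume.restrict (Set.Ioc (-Real.pi) Real.pi)).map
      (fun θ : ℝ => (Real.cos θ, Real.sin θ))).withDensity
    (fun s => ENNReal.ofReal
      (Real.exp (κ * (m.1 * s.1 + m.2 * s.2)) / (2 * Real.pi * besselI 0 κ)))

/-- The mean direction `(1, 1) / √2`. -/
def diagDir : ℝ × ℝ := (1 / √2, 1 / √2)

/-- The measure on the pairs `(α², ω) ∈ (0, ∞) × ℝ` with Lebesgue density `φ(α², ω)`. -/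
def paramLaw (φ : ℝ → ℝ → ℝ) : Measure (ℝ × ℝ) :=
  (volume.restrict (Set.Ioi (0 : ℝ) ×ˢ (Set.univ : Set ℝ))).withDensity
    (fun p => ENNReal.ofReal (φ p.1 p.2))

/-- The impulse response of the concatenation of `n` one-dimensional quantum harmonic oscillators
with parameters `α i`, `ω i`, `s i = (s_{i1}, s_{i2})`, without the feedthrough `(∑ i, s_{i1}) δ(t)`,
which is concentrated at `t = 0`: for `t > 0` this is the value `h̃(t)`. -/
def impulseResponse (n : ℕ) (α ω : ℕ → ℝ) (s : ℕ → ℝ × ℝ) (t : ℝ) : ℝ :=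
  ∑ i ∈ Finset.range n, (α i) ^ 2 * Real.exp (-((α i) ^ 2 * t / 2)) *
    (-(s i).1 * Real.cos (ω i * t) + (s i).2 * Real.sin (ω i * t))

/-- The mean function `μ_h`; the variable `x` stands for `α²`. -/
def muH (κ : ℝ) (φ : ℝ → ℝ → ℝ) (t : ℝ) : ℝ :=
  -(r₁ κ / √2) * ∫ ω : ℝ, ∫ x in Set.Ioi (0 : ℝ),
    x * Real.exp (-(x * t / 2)) * Real.cos (ω * t) * φ x ω

/-- The limit kernel `K_θ`; the variable `x` stands for `α²`. -/
def limitKernel (κ : ℝ) (φ : ℝ → ℝ → ℝ) (t t' : ℝ) : ℝ :=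
  1 / 2 * (∫ ω : ℝ, ∫ x in Set.Ioi (0 : ℝ),
    x ^ 2 * Real.exp (-(x * (t + t') / 2)) * Real.cos (ω * (t - t')) * φ x ω)
    - muH κ φ t * muH κ φ t'

/-- The Cauchy-times-uniform density: `α²` is uniform on `[a_m, a_M]` and, given `α²`, `ω` is
Cauchy with location `0` and scale `α² / 2`. -/
def cauchyUniform (a_m a_M : ℝ) (x ω : ℝ) : ℝ :=
  (x / 2) / (Real.pi * (ω ^ 2 + x ^ 2 / 4)) *
    (Set.Icc a_m a_M).indicator (fun _ => 1 / (a_M - a_m)) x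

/-- The real processes `X n`, on the probability space `(Ω, P)`, converge in distribution as
`n → ∞`, on the time set `T`, to the Gaussian process `GP(0, K)`: such a process `G` exists, and all
finite-dimensional distributions converge weakly to those of `G`. -/
def ConvergesToGP {Ω : Type*} [MeasurableSpace Ω] (P : Measure Ω) [IsProbabilityMeasure P]
    (T : Set ℝ) (X : ℕ → ℝ → Ω → ℝ) (K : ℝ → ℝ → ℝ) : Prop :=
  ∃ (Ω' : Type) (_ : MeasurableSpace Ω') (Q : Measure Ω') (_ : IsProbabilityMeasure Q)
    (G : T → Ω' → ℝ),
    IsGaussianProcess G Q ∧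
    (∀ t : T, ∫ ω', G t ω' ∂Q = 0) ∧
    (∀ t t' : T, covariance (G t) (G t') Q = K t t') ∧
    ∀ (k : ℕ) (t : Fin k → T),
      TendstoInDistribution (fun (n : ℕ) (ω : Ω) (j : Fin k) => X n (t j) ω) atTop
        (fun (ω' : Ω') (j : Fin k) => G (t j) ω') (fun _ => P) Q

end QWiener

end

namespace QWiener

open scoped NNReal ENNReal

/-! ### Construction of an isonormal Gaussian process on a Hilbert space. -/

section Isonormal

/-! The impulse response at time `t` is a sum of i.i.d. copies of one function `response t` of a
single oscillator's parameters `((α², ω), s)`, whose law is the product of `paramLaw φ` and the von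
Mises law. For any square-integrable family `f t` on a probability space `ν`, the Cramér–Wold device
reduces finite-dimensional convergence to the scalar central limit theorem (`convergesToGP_of_iid`).
The limit process is written down directly: an isonormal process on `L²(ν)` (`exists_isonormal`),
evaluated at the centred functions `f t - m t`, is Gaussian with the covariance of the `f t`.

It remains to find when `response t` is square-integrable, and its moments. For `t > 0` the envelope
`x exp(-xt/2)` is bounded; at `t = 0` it is `α²`, so a finite second moment of `α²` is needed.
Evenness of `φ` in `ω` kills every term with an odd number of sines. Reflection in the diagonal
makes the two coordinates of `s` exchangeable, so `E s₁ = r₁/√2` and `E s₁² = E s₂² = 1/2`; the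
equal weights merge `cos cos + sin sin` into `cos (ω (t - t'))` (`integral_response`,
`covariance_response`).

For the explicit formulas, averaging the cosine over a Cauchy frequency of scale `x/2` gives
`exp(-x|t|/2)` (`integral_cos_mul_cauchyUniform`). Combined with the damping this leaves an
elementary integral over `[a_m, a_M]`. -/

lemma ae_eq_coeFn_sum_smul {Ω ι : Type*} {mΩ : MeasurableSpace Ω} {Q : Measure Ω}
    (s : Finset ι) (c : ι → ℝ) (h : ι → Lp ℝ 2 Q) :
    (fun o => ∑ i ∈ s, c i * h i o) =ᵐ[Q] ⇑(∑ i ∈ s, c i • h i) := by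
  have h1 : ∀ᵐ o ∂Q, ∀ i ∈ s, (c i • h i) o = c i * h i o := by
    rw [Finset.eventually_all]
    intro i _
    filter_upwards [Lp.coeFn_smul (c i) (h i)] with o ho
    simpa using ho
  filter_upwards [h1, Lp.coeFn_finsetSum s (fun i => c i • h i)] with o ho ho'
  rw [ho', Finset.sum_apply]
  exact Finset.sum_congr rfl fun i hi => (ho i hi).symm

lemma norm_exp_mul_I_sub_exp_mul_I_le (x y : ℝ) :
    ‖Complex.exp (x * Complex.I) - Complex.exp (y * Complex.I)‖ ≤ ‖x - y‖ := by
  have h : Complex.exp (x * Complex.I) - Complex.exp (y * Complex.I) =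
      Complex.exp (y * Complex.I) * (Complex.exp (Complex.I * ((x - y : ℝ) : ℂ)) - 1) := by
    rw [mul_sub, ← Complex.exp_add]
    push_cast
    ring_nf
  rw [h, norm_mul, Complex.norm_exp_ofReal_mul_I, one_mul]
  exact Real.norm_exp_I_mul_ofReal_sub_one_le

lemma integrable_exp_mul_I {Ω : Type*} {mΩ : MeasurableSpace Ω} {Q : Measure Ω}
    [IsFiniteMeasure Q] {X : Ω → ℝ} (hX : AEMeasurable X Q) :
    Integrable (fun o => Complex.exp (X o * Complex.I)) Q := by
  refine Integrable.of_bound (C := 1) ?_ (ae_of_all _ fun o => ?_)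
  · exact AEMeasurable.aestronglyMeasurable (by fun_prop)
  · rw [Complex.norm_exp_ofReal_mul_I]

/-- The characteristic function at `1` is a continuous function of the random variable in `L²`. -/
lemma continuous_integral_exp_mul_I {Ω : Type*} {mΩ : MeasurableSpace Ω} {Q : Measure Ω}
    [IsProbabilityMeasure Q] :
    Continuous (fun f : Lp ℝ 2 Q => ∫ o, Complex.exp (f o * Complex.I) ∂Q) := by
  refine (LipschitzWith.of_dist_le_mul (K := 1) fun f g => ?_).continuous
  rw [dist_eq_norm, dist_eq_norm, NNReal.coe_one, one_mul,
    ← integral_sub (integrable_exp_mul_I (Lp.aestronglyMeasurable f).aemeasurable)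
      (integrable_exp_mul_I (Lp.aestronglyMeasurable g).aemeasurable)]
  have hm : MemLp (f - g : Lp ℝ 2 Q) 1 Q := (Lp.memLp (f - g)).mono_exponent (by norm_num)
  calc ‖∫ o, (Complex.exp (f o * Complex.I) - Complex.exp (g o * Complex.I)) ∂Q‖
      ≤ ∫ o, ‖(f - g : Lp ℝ 2 Q) o‖ ∂Q := by
        refine norm_integral_le_of_norm_le (memLp_one_iff_integrable.1 hm).norm ?_
        filter_upwards [Lp.coeFn_sub f g] with o ho
        rw [ho]
        exact norm_exp_mul_I_sub_exp_mul_I_le _ _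
    _ = (eLpNorm (f - g : Lp ℝ 2 Q) 1 Q).toReal := by
        rw [integral_norm_eq_lintegral_enorm hm.1, eLpNorm_one_eq_lintegral_enorm]
    _ ≤ ‖f - g‖ := by
        rw [Lp.norm_def]
        exact ENNReal.toReal_mono (Lp.eLpNorm_ne_top _)
          (eLpNorm_le_eLpNorm_of_exponent_le (by norm_num) hm.1)

/-- Every real Hilbert space carries an isonormal Gaussian process. -/
theorem exists_isonormal (H : Type) [NormedAddCommGroup H] [InnerProductSpace ℝ H]
    [CompleteSpace H] :
    ∃ (Ω : Type) (_ : MeasurableSpace Ω) (Q : Measure Ω) (_ : IsProbabilityMeasure Q)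
      (W : H →ₗᵢ[ℝ] Lp ℝ 2 Q), ∀ h, HasLaw (W h) (gaussianReal 0 (‖h‖₊ ^ 2)) Q := by
  classical
  obtain ⟨ι, b, -⟩ := exists_hilbertBasis ℝ H
  let Q : Measure (ι → ℝ) := Measure.infinitePi (fun _ : ι => gaussianReal 0 1)
  have hlaw (i : ι) : HasLaw (fun x : ι → ℝ => x i) (gaussianReal 0 1) Q :=
    (measurePreserving_eval_infinitePi (fun _ : ι => gaussianReal 0 1) i).hasLaw
  have hindep : iIndepFun (fun (i : ι) (x : ι → ℝ) => x i) Q :=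
    iIndepFun_infinitePi (X := fun _ x => x) (fun _ => measurable_id)
  have hmem (i : ι) : MemLp (fun x : ι → ℝ => x i) 2 Q :=
    (hlaw i).hasGaussianLaw.memLp_two
  have hmean (i : ι) : ∫ x, x i ∂Q = 0 := by
    rw [(hlaw i).integral_eq]; simp
  have hvar (i : ι) : Var[fun x : ι → ℝ => x i; Q] = 1 := by
    rw [(hlaw i).variance_eq]; simp
  let ξ (i : ι) : Lp ℝ 2 Q := (hmem i).toLp
  have hinner (i j : ι) : inner ℝ (ξ i) (ξ j) = cov[fun x : ι → ℝ => x i, fun x => x j; Q] := by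
    rw [covariance_eq_sub (hmem i) (hmem j), hmean i, zero_mul, sub_zero, L2.inner_def]
    refine integral_congr_ae ?_
    filter_upwards [(hmem i).coeFn_toLp, (hmem j).coeFn_toLp] with x hi hj
    simp only [ξ, hi, hj, Pi.mul_apply, RCLike.inner_apply]
    simp [mul_comm]
  have hξ : Orthonormal ℝ ξ := by
    rw [orthonormal_iff_ite]
    intro i j
    rw [hinner]
    split_ifs with hij
    · subst hij
      rw [covariance_self (hlaw i).aemeasurable, hvar]
    · exact (hindep.indepFun hij).covariance_eq_zero (hmem i) (hmem j)
  -- Independent standard Gaussians are orthonormal in `L²`, so sending the Hilbert basis to them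
  -- extends to an isometry.
  let W : H →ₗᵢ[ℝ] Lp ℝ 2 Q :=
    hξ.orthogonalFamily.linearIsometry.comp b.repr.toLinearIsometry
  have hWb (i : ι) : W (b i) = ξ i := by
    simp [W, b.repr_self, OrthogonalFamily.linearIsometry_apply_single]
  -- On finite combinations of basis vectors independence factors the characteristic function;
  -- `hchar` then passes to the limit along the basis expansion, both sides being continuous in `h`.
  have hfin (c : ι → ℝ) (s : Finset ι) :
      ∫ o, Complex.exp ((W (∑ i ∈ s, c i • b i)) o * Complex.I) ∂Q =
        Complex.exp (-(‖∑ i ∈ s, c i • b i‖ ^ 2 : ℝ) / 2) := by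
    have hae : (fun x : ι → ℝ => ∑ i ∈ s, c i * x i) =ᵐ[Q] W (∑ i ∈ s, c i • b i) := by
      have h1 : ∀ᵐ x ∂Q, ∀ i ∈ s, ξ i x = x i := by
        rw [Finset.eventually_all]
        exact fun i _ => (hmem i).coeFn_toLp
      have h2 := ae_eq_coeFn_sum_smul (Q := Q) s c ξ
      simp only [map_sum, map_smul, hWb]
      filter_upwards [h1, h2] with x hx hx'
      rw [← hx']
      exact Finset.sum_congr rfl fun i hi => by rw [hx i hi]
    have hnorm : ‖∑ i ∈ s, c i • b i‖ ^ 2 = ∑ i ∈ s, c i ^ 2 := by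
      rw [← real_inner_self_eq_norm_sq, b.orthonormal.inner_sum]
      simp [sq]
    have hch := (iIndepFun.charFun_map_fun_finsetSum_eq_prod (s := s)
      (X := fun i (x : ι → ℝ) => c i * x i) (P := Q) (fun i _ => (hlaw i).aemeasurable.const_mul _)
      ((hindep.comp (fun i x => c i * x) (fun i => by fun_prop)).precomp
        (g := fun i : s => (i : ι)) Subtype.val_injective))
    have hch1 := congrFun hch 1
    rw [charFun_apply_real, integral_map
      (Finset.aemeasurable_fun_sum _ fun i _ => (hlaw i).aemeasurable.const_mul _)
      (by exact AEMeasurable.aestronglyMeasurable (by fun_prop)), Finset.prod_apply] at hch1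
    rw [hnorm, integral_congr_ae (g := fun x : ι → ℝ =>
      Complex.exp ((1 : ℝ) * ((∑ i ∈ s, c i * x i : ℝ) : ℂ) * Complex.I)), hch1]
    · rw [Complex.ofReal_sum, ← Finset.sum_neg_distrib, Finset.sum_div, Complex.exp_sum]
      refine Finset.prod_congr rfl fun i _ => ?_
      rw [charFun_map_mul_comp (hlaw i).aemeasurable, (hlaw i).map_eq, charFun_gaussianReal]
      simp [neg_div]
    · filter_upwards [hae] with x hx
      rw [← hx, Complex.ofReal_one, one_mul]
  have hchar (h : H) : ∫ o, Complex.exp ((W h) o * Complex.I) ∂Q =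
      Complex.exp (-(‖h‖ ^ 2 : ℝ) / 2) := by
    have hs := b.hasSum_repr h
    have hF : Continuous fun h : H => ∫ o, Complex.exp ((W h) o * Complex.I) ∂Q :=
      continuous_integral_exp_mul_I.comp W.continuous
    have hE : Continuous fun h : H => Complex.exp (-(‖h‖ ^ 2 : ℝ) / 2) := by fun_prop
    have h1 := (hF.tendsto h).comp hs
    have h2 := (hE.tendsto h).comp hs
    refine tendsto_nhds_unique (h1.congr fun s => ?_) h2
    exact hfin (b.repr h) s
  refine ⟨ι → ℝ, inferInstance, Q, inferInstance, W, fun h => ?_⟩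
  have hm : AEMeasurable (W h) Q := (Lp.aestronglyMeasurable _).aemeasurable
  have := Q.isProbabilityMeasure_map hm
  refine ⟨hm, Measure.ext_of_charFun (funext fun u => ?_)⟩
  -- By linearity, the characteristic function of `W h` at `u` is that of `W (u • h)` at `1`.
  rw [charFun_apply_real, integral_map hm
      (by exact AEMeasurable.aestronglyMeasurable (by fun_prop)), charFun_gaussianReal,
      integral_congr_ae (g := fun o => Complex.exp ((W (u • h)) o * Complex.I)), hchar]
  · rw [norm_smul]
    simp only [mul_pow, Real.norm_eq_abs, sq_abs]
    push_cast
    simp only [mul_zero, zero_mul, zero_sub]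
    congr 1
    ring
  · rw [map_smul]
    filter_upwards [Lp.coeFn_smul u (W h)] with o ho
    rw [ho]
    simp

end Isonormal

/-! ### Cramér–Wold device and the central limit theorem for processes. -/

section CLT

variable {Ω Ω' : Type*} {mΩ : MeasurableSpace Ω} {mΩ' : MeasurableSpace Ω'}
  {P : Measure Ω} {Q : Measure Ω'}

/-- The passage to `EuclideanSpace` supplies the inner product that `charFun` requires; the identity
is what reduces vector convergence to linear forms. -/
lemma charFun_map_toLp {ι : Type*} [Fintype ι] {X : Ω → ι → ℝ} (hX : AEMeasurable X P)
    (c : EuclideanSpace ℝ ι) :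
    charFun (P.map (fun o => WithLp.toLp 2 (X o))) c =
      charFun (P.map (fun o => ∑ j, c j * X o j)) 1 := by
  rw [charFun_apply, charFun_apply_real, integral_map (by fun_prop)
    (by exact AEMeasurable.aestronglyMeasurable (by fun_prop)), integral_map (by fun_prop)
    (by exact AEMeasurable.aestronglyMeasurable (by fun_prop))]
  simp [PiLp.inner_apply]

variable [IsProbabilityMeasure P] [IsProbabilityMeasure Q]

/-- The **Cramér–Wold device**. -/
theorem tendstoInDistribution_pi_of_forall_sum_mul {ι : Type*} [Fintype ι]
    {X : ℕ → Ω → ι → ℝ} {Z : Ω' → ι → ℝ}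
    (hX : ∀ n, AEMeasurable (X n) P) (hZ : AEMeasurable Z Q)
    (h : ∀ c : ι → ℝ, TendstoInDistribution (fun n o => ∑ j, c j * X n o j) atTop
      (fun o => ∑ j, c j * Z o j) (fun _ => P) Q) :
    TendstoInDistribution X atTop Z (fun _ => P) Q := by
  have key : TendstoInDistribution (fun n o => WithLp.toLp 2 (X n o)) atTop
      (fun o => WithLp.toLp 2 (Z o)) (fun _ => P) Q := by
    refine ⟨fun n => by have := hX n; fun_prop, by fun_prop, ?_⟩
    refine ProbabilityMeasure.tendsto_iff_tendsto_charFun.2 fun c => ?_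
    have := ProbabilityMeasure.tendsto_iff_tendsto_charFun.1 (h c).tendsto 1
    simp only [ProbabilityMeasure.coe_mk] at this ⊢
    rw [charFun_map_toLp hZ]
    simpa only [charFun_map_toLp (hX _)] using this
  exact key.continuous_comp (g := WithLp.ofLp) (by fun_prop)

/-- Central limit theorem for the finite-dimensional distributions of the empirical process of
an i.i.d. sequence, indexed by a family of square-integrable functions. -/
theorem convergesToGP_of_iid {S : Type} [MeasurableSpace S] {ν : Measure S}
    [IsProbabilityMeasure ν] {Z : ℕ → Ω → S} (hZ : ∀ i, HasLaw (Z i) ν P) (hind : iIndepFun Z P)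
    {T : Set ℝ} {f : ℝ → S → ℝ} (hf : ∀ t, Measurable (f t)) (hL2 : ∀ t ∈ T, MemLp (f t) 2 ν)
    {m : ℝ → ℝ} {K : ℝ → ℝ → ℝ} (hm : ∀ t ∈ T, ∫ z, f t z ∂ν = m t)
    (hK : ∀ t ∈ T, ∀ t' ∈ T, cov[f t, f t'; ν] = K t t') :
    ConvergesToGP P T
      (fun n t o => √(n : ℝ) * ((∑ i ∈ Finset.range n, f t (Z i o)) / n - m t)) K := by
  obtain ⟨Ω', mΩ', Q, hQ, W, hW⟩ := exists_isonormal (Lp ℝ 2 ν)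
  have hcL (t : T) : MemLp (fun z => f t z - m t) 2 ν :=
    (hL2 t t.2).sub (memLp_const _)
  let g (t : T) : Lp ℝ 2 ν := (hcL t).toLp
  have hlin {ι : Type} [Fintype ι] (c : ι → ℝ) (t : ι → T) :
      HasLaw (fun o => ∑ j, c j * W (g (t j)) o)
        (gaussianReal 0 (‖∑ j, c j • g (t j)‖₊ ^ 2)) Q := by
    refine (hW _).congr ?_
    simpa using ae_eq_coeFn_sum_smul Finset.univ c (fun j => W (g (t j)))
  have hmean (t : T) : ∫ o, W (g t) o ∂Q = 0 := by
    rw [(hW _).integral_eq]; simp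
  have hmeas (t : T) : AEMeasurable (W (g t)) Q := (Lp.aestronglyMeasurable _).aemeasurable
  refine ⟨Ω', mΩ', Q, hQ, fun t => W (g t), ⟨fun I => ⟨?_⟩⟩, hmean, fun t t' => ?_,
    fun k t => ?_⟩
  · refine isGaussian_of_map_eq_gaussianReal fun L => ?_
    -- A linear form `L` has coefficients `L (Pi.single j 1)`, so its value on the process is `W` of
    -- one vector of `L²(ν)`.
    refine ⟨0, ‖∑ j : I, L (Pi.single j 1) • g j‖₊ ^ 2, ?_⟩
    have hr : AEMeasurable (fun o => I.restrict fun t => W (g t) o) Q :=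
      aemeasurable_pi_lambda _ fun j => hmeas j
    rw [AEMeasurable.map_map_of_aemeasurable (by fun_prop) hr,
      ← (hlin (fun j : I => L (Pi.single j 1)) (fun j => j)).map_eq]
    congr 1
    ext o
    simp only [Function.comp_apply]
    rw [← ContinuousLinearMap.coe_coe, LinearMap.pi_apply_eq_sum_univ]
    refine Finset.sum_congr rfl fun j _ => ?_
    rw [smul_eq_mul, mul_comm]
    congr 3
    ext i
    simp [Pi.single_apply, eq_comm]
  · rw [covariance_eq_sub (Lp.memLp _) (Lp.memLp _), hmean, zero_mul, sub_zero,
      ← hK t t.2 t' t'.2]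
    have h1 : ∫ o, (W (g t) * W (g t') : Ω' → ℝ) o ∂Q = inner ℝ (W (g t)) (W (g t')) := by
      rw [L2.inner_def]
      refine integral_congr_ae (ae_of_all _ fun o => ?_)
      simp [mul_comm]
    rw [h1, W.inner_map_map, L2.inner_def, covariance, hm t t.2, hm t' t'.2]
    refine integral_congr_ae ?_
    filter_upwards [(hcL t).coeFn_toLp, (hcL t').coeFn_toLp] with z h h'
    simp only [g, h, h']
    simp [mul_comm]
  · have hZm (i : ℕ) : AEMeasurable (Z i) P := (hZ i).aemeasurable
    have hfZ (t : ℝ) (i : ℕ) : AEMeasurable (fun o => f t (Z i o)) P :=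
      (hf t).comp_aemeasurable (hZm i)
    refine tendstoInDistribution_pi_of_forall_sum_mul (fun n => ?_) ?_ fun c => ?_
    · exact aemeasurable_pi_lambda _ fun j => (((Finset.aemeasurable_fun_sum _ fun i _ =>
        hfZ _ i).div_const _).sub_const _).const_mul _
    · exact aemeasurable_pi_lambda _ fun j => hmeas _
    let F : S → ℝ := fun z => ∑ j, c j * f (t j) z
    have hFm : Measurable F := Finset.measurable_fun_sum _ fun j _ => (hf _).const_mul _
    have hFL : MemLp F 2 ν := memLp_finsetSum _ fun j _ => (hL2 _ (t j).2).const_mul _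
    have hFint : ∫ z, F z ∂ν = ∑ j, c j * m (t j) := by
      rw [integral_finsetSum _ fun j _ => ((hL2 _ (t j).2).integrable (by norm_num)).const_mul _]
      simp_rw [integral_const_mul, hm _ (t _).2]
    -- The variance of the summand is the squared `L²(ν)` norm of its centring, which is the
    -- variance of the Gaussian limit because `W` is isometric.
    have hFvar : (Var[F ∘ Z 0; P]).toNNReal = ‖∑ j, c j • g (t j)‖₊ ^ 2 := by
      rw [← covariance_self (hFm.comp_aemeasurable (hZm 0)),
        (hZ 0).covariance_comp hFm.aemeasurable hFm.aemeasurable, ← NNReal.coe_inj,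
        covariance_self hFm.aemeasurable, Real.coe_toNNReal _ (variance_nonneg _ _),
        variance_eq_integral hFm.aemeasurable, NNReal.coe_pow, coe_nnnorm,
        ← real_inner_self_eq_norm_sq, L2.inner_def]
      refine integral_congr_ae ?_
      have h1 : ∀ᵐ z ∂ν, ∀ j, g (t j) z = f (t j) z - m (t j) := by
        rw [ae_all_iff]
        exact fun j => (hcL (t j)).coeFn_toLp
      filter_upwards [h1, ae_eq_coeFn_sum_smul Finset.univ c (fun j => g (t j))] with z hz hz'
      rw [← hz', hFint]
      simp only [hz, F, mul_sub, Finset.sum_sub_distrib]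
      simp [sq]
    have hclt := tendstoInDistribution_inv_sqrt_mul_sum_sub (P := P) (P' := Q)
      (X := fun i => F ∘ Z i) (Y := fun o => ∑ j, c j * W (g (t j)) o)
      (by rw [hFvar]; exact hlin c t)
      ((memLp_map_measure_iff ((hZ 0).map_eq ▸ hFL.1) (hZm 0)).1 ((hZ 0).map_eq ▸ hFL))
      (hind.comp (fun _ => F) fun _ => hFm)
      (fun i => ⟨hFm.comp_aemeasurable (hZm i), hFm.comp_aemeasurable (hZm 0), by
        rw [← AEMeasurable.map_map_of_aemeasurable hFm.aemeasurable (hZm i),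
          ← AEMeasurable.map_map_of_aemeasurable hFm.aemeasurable (hZm 0),
          (hZ i).map_eq, (hZ 0).map_eq]⟩)
    convert! hclt using 3 with n o
    rw [(hZ 0).integral_comp hFm.aestronglyMeasurable, hFint]
    have hsum : ∑ i ∈ Finset.range n, (F ∘ Z i) o =
        ∑ j, c j * ∑ i ∈ Finset.range n, f (t j) (Z i o) := by
      simp only [F, Function.comp_apply, Finset.mul_sum]
      exact Finset.sum_comm
    rw [hsum, Finset.mul_sum, ← Finset.sum_sub_distrib, Finset.mul_sum]
    refine Finset.sum_congr rfl fun j _ => ?_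
    -- At `n = 0` both normalisations vanish, since `√0 = 0` and `0⁻¹ = 0`.
    rcases Nat.eq_zero_or_pos n with rfl | hn
    · simp
    · have hn' : (0 : ℝ) < n := by exact_mod_cast hn
      have hs : √(n : ℝ) ≠ 0 := (Real.sqrt_pos.2 hn').ne'
      field_simp
      rw [Real.sq_sqrt hn'.le]

end CLT

/-! ### Cauchy characteristic function and the closed formulas. -/

section Cauchy

/-- Splitting at `0` leaves two pure complex exponentials with rates `±γ + iu`. Fourier inversion of
this transform yields the Cauchy characteristic function. -/
lemma hasIntegral_exp_neg_abs_mul_exp {γ : ℝ} (hγ : 0 < γ) (u : ℝ) :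
    Integrable (fun x : ℝ => Complex.exp (u * x * Complex.I) * (Real.exp (-(γ * |x|)) : ℂ)) ∧
    ∫ x : ℝ, Complex.exp (u * x * Complex.I) * (Real.exp (-(γ * |x|)) : ℂ) =
      ((2 * γ / (γ ^ 2 + u ^ 2) : ℝ) : ℂ) := by
  let a : ℂ := γ + u * Complex.I
  let b : ℂ := -γ + u * Complex.I
  have ha : 0 < a.re := by simpa [a] using hγ
  have hb : b.re < 0 := by simpa [b] using hγ
  have hle : ∀ x ∈ Set.Iic (0 : ℝ), Complex.exp (a * x) =
      Complex.exp (u * x * Complex.I) * (Real.exp (-(γ * |x|)) : ℂ) := by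
    intro x hx
    rw [abs_of_nonpos hx, Complex.ofReal_exp, ← Complex.exp_add]
    push_cast [a]
    ring_nf
  have hgt : ∀ x ∈ Set.Ioi (0 : ℝ), Complex.exp (b * x) =
      Complex.exp (u * x * Complex.I) * (Real.exp (-(γ * |x|)) : ℂ) := by
    intro x hx
    rw [abs_of_pos hx, Complex.ofReal_exp, ← Complex.exp_add]
    push_cast [b]
    ring_nf
  have h1 := (integrableOn_exp_mul_complex_Iic ha 0).congr_fun hle measurableSet_Iic
  have h2 := (integrableOn_exp_mul_complex_Ioi hb 0).congr_fun hgt measurableSet_Ioi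
  refine ⟨?_, ?_⟩
  · rw [← integrableOn_univ, ← Set.Iic_union_Ioi (a := (0 : ℝ))]
    exact h1.union h2
  · rw [← intervalIntegral.integral_Iic_add_Ioi h1 h2,
      ← setIntegral_congr_fun measurableSet_Iic hle, ← setIntegral_congr_fun measurableSet_Ioi hgt,
      integral_exp_mul_complex_Iic ha, integral_exp_mul_complex_Ioi hb]
    have ha0 : a ≠ 0 := fun h => by simp [h] at ha
    have hb0 : b ≠ 0 := fun h => by simp [h] at hb
    have hab : a * b = -((γ ^ 2 + u ^ 2 : ℝ) : ℂ) := by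
      push_cast [a, b]
      linear_combination (u : ℂ) ^ 2 * Complex.I_sq
    have h0 : ((γ ^ 2 + u ^ 2 : ℝ) : ℂ) ≠ 0 := by
      rw [Complex.ofReal_ne_zero]; positivity
    have hsub : b - a = -(2 * γ : ℂ) := by simp only [a, b]; ring
    simp only [Complex.ofReal_zero, mul_zero, Complex.exp_zero]
    rw [div_add_div _ _ ha0 hb0, Complex.ofReal_div, div_eq_div_iff (mul_ne_zero ha0 hb0) h0, hab]
    push_cast
    linear_combination ((γ : ℂ) ^ 2 + (u : ℂ) ^ 2) * hsub

lemma integrable_inv_sq_add_sq {γ : ℝ} (hγ : 0 < γ) :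
    Integrable (fun w : ℝ => (w ^ 2 + γ ^ 2)⁻¹) := by
  have h := ((integrable_inv_one_add_sq.comp_mul_left' (inv_ne_zero hγ.ne')).const_mul (γ ^ 2)⁻¹)
  refine h.congr (ae_of_all _ fun w => ?_)
  simp only
  field_simp
  rw [add_comm]

/-- The characteristic function of the Cauchy distribution. -/
lemma integral_exp_mul_cauchy {γ : ℝ} (hγ : 0 < γ) (t : ℝ) :
    ∫ w : ℝ, Complex.exp ((w * t : ℝ) * Complex.I) * ((γ / (Real.pi * (w ^ 2 + γ ^ 2)) : ℝ) : ℂ) =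
      (Real.exp (-(γ * |t|)) : ℂ) := by
  let f : ℝ → ℂ := fun x => (Real.exp (-(γ * |x|)) : ℂ)
  have hπ := Real.pi_pos
  have hF : FourierTransform.fourier f =
      fun ξ => ((2 * γ / (γ ^ 2 + (2 * Real.pi * ξ) ^ 2) : ℝ) : ℂ) := by
    ext ξ
    rw [Real.fourier_real_eq_integral_exp_smul]
    have := (hasIntegral_exp_neg_abs_mul_exp hγ (-2 * Real.pi * ξ)).2
    rw [show (2 * Real.pi * ξ) ^ 2 = (-2 * Real.pi * ξ) ^ 2 by ring, ← this]
    refine integral_congr_ae (ae_of_all _ fun x => ?_)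
    simp only [smul_eq_mul, f]
    push_cast
    ring_nf
  have hfi : Integrable f := by
    simpa [f] using (hasIntegral_exp_neg_abs_mul_exp hγ 0).1
  have hFi : Integrable (FourierTransform.fourier f) := by
    rw [hF]
    refine Integrable.ofReal (𝕜 := ℂ) (f := fun ξ : ℝ => 2 * γ / (γ ^ 2 + (2 * Real.pi * ξ) ^ 2)) ?_
    have h := ((integrable_inv_sq_add_sq hγ).comp_mul_left'
      (R := 2 * Real.pi) (by positivity)).const_mul (2 * γ)
    refine h.congr (ae_of_all _ fun ξ => ?_)
    simp only [div_eq_mul_inv, add_comm]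
  have hfc : Continuous f := by fun_prop
  have hinv := congrFun (hfc.fourierInv_fourier_eq hfi hFi) t
  rw [hF, Real.fourierInv_eq'] at hinv
  change _ = f t
  rw [← hinv]
  -- Substitution `w = 2πξ`, matching the `2π` in the exponent of the Fourier transform.
  have hsub := Measure.integral_comp_mul_left (fun w : ℝ =>
    Complex.exp ((w * t : ℝ) * Complex.I) * ((γ / (Real.pi * (w ^ 2 + γ ^ 2)) : ℝ) : ℂ))
    (2 * Real.pi)
  rw [abs_of_pos (by positivity)] at hsub
  rw [← inv_smul_eq_iff₀ (by positivity)] at hsub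
  rw [← hsub, inv_inv, ← integral_smul]
  refine integral_congr_ae (ae_of_all _ fun ξ => ?_)
  have h1 : ((2 * γ / (γ ^ 2 + (2 * Real.pi * ξ) ^ 2) : ℝ) : ℂ) =
      ((2 * Real.pi : ℝ) : ℂ) * ((γ / (Real.pi * ((2 * Real.pi * ξ) ^ 2 + γ ^ 2)) : ℝ) : ℂ) := by
    rw [← Complex.ofReal_mul]
    congr 1
    field_simp
    ring
  simp only [h1, smul_eq_mul, Complex.real_smul]
  simp only [RCLike.inner_apply, conj_trivial]
  rw [show 2 * Real.pi * (t * ξ) = 2 * Real.pi * ξ * t by ring]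
  ring

lemma integral_cos_mul_cauchy {γ : ℝ} (hγ : 0 < γ) (t : ℝ) :
    ∫ w : ℝ, Real.cos (w * t) * (γ / (Real.pi * (w ^ 2 + γ ^ 2))) = Real.exp (-(γ * |t|)) := by
  have h := congrArg Complex.re (integral_exp_mul_cauchy hγ t)
  rw [Complex.ofReal_re, ← RCLike.re_to_complex, ← integral_re] at h
  · rw [← h]
    refine integral_congr_ae (ae_of_all _ fun w => ?_)
    simp only [RCLike.re_to_complex]
    rw [Complex.re_mul_ofReal, Complex.exp_ofReal_mul_I_re]
  · have hi : Integrable fun w : ℝ => γ / (Real.pi * (w ^ 2 + γ ^ 2)) := by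
      refine ((integrable_inv_sq_add_sq hγ).const_mul (γ / Real.pi)).congr
        (ae_of_all _ fun w => ?_)
      simp only
      rw [div_mul_eq_div_div, div_eq_mul_inv _ (w ^ 2 + γ ^ 2)]
    refine hi.ofReal.bdd_mul (c := 1) ?_ (ae_of_all _ fun w => ?_)
    · exact Continuous.aestronglyMeasurable (by fun_prop)
    · rw [Complex.norm_exp_ofReal_mul_I]

/-- Fubini puts the frequency integral inside, where it is the characteristic function of a Cauchy
law of scale `x / 2`. -/
lemma integral_cos_mul_cauchyUniform {a_m a_M : ℝ} (ha : 0 < a_m) (haM : a_m < a_M)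
    {g : ℝ → ℝ} (hg : Continuous g) (t : ℝ) :
    ∫ w : ℝ, ∫ x in Set.Ioi (0 : ℝ), g x * Real.cos (w * t) * cauchyUniform a_m a_M x w =
      (∫ x in a_m..a_M, g x * Real.exp (-(x / 2 * |t|))) / (a_M - a_m) := by
  have hπ := Real.pi_pos
  have hd : 0 < a_M - a_m := sub_pos.2 haM
  have hsub : Set.Icc a_m a_M ⊆ Set.Ioi 0 := fun x hx => ha.trans_le hx.1
  have hInner (w : ℝ) :
      ∫ x in Set.Ioi (0 : ℝ), g x * Real.cos (w * t) * cauchyUniform a_m a_M x w =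
      ∫ x in Set.Icc a_m a_M, g x / (a_M - a_m) *
        (Real.cos (w * t) * ((x / 2) / (Real.pi * (w ^ 2 + (x / 2) ^ 2)))) := by
    rw [← Set.inter_eq_self_of_subset_right hsub, ← setIntegral_indicator measurableSet_Icc]
    refine setIntegral_congr_fun measurableSet_Ioi fun x _ => ?_
    simp only [cauchyUniform, Set.indicator]
    split_ifs
    · rw [show (x / 2) ^ 2 = x ^ 2 / 4 by ring]
      ring
    · simp
  simp_rw [hInner]
  have hInt : Integrable (Function.uncurry fun (w x : ℝ) => g x / (a_M - a_m) *
        (Real.cos (w * t) * ((x / 2) / (Real.pi * (w ^ 2 + (x / 2) ^ 2)))))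
      (volume.prod (volume.restrict (Set.Icc a_m a_M))) := by
    have hgi : IntegrableOn (fun x => |g x| / (a_M - a_m) * (a_M / 2 / Real.pi))
        (Set.Icc a_m a_M) := (by fun_prop : Continuous _).integrableOn_Icc
    -- Since `a_m ≤ x ≤ a_M`, the Cauchy density is dominated uniformly in `x`, with `a_M` in the
    -- numerator and `a_m` in the denominator.
    have hdom := (integrable_inv_sq_add_sq (half_pos ha)).mul_prod hgi
    refine hdom.mono' ?_ ?_
    · refine Measurable.aestronglyMeasurable ?_
      have := hg.measurable
      fun_prop
    · have hmem : ∀ᵐ p : ℝ × ℝ ∂(volume.prod (volume.restrict (Set.Icc a_m a_M))),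
          p.2 ∈ Set.Icc a_m a_M :=
        Measure.quasiMeasurePreserving_snd.ae (ae_restrict_mem measurableSet_Icc)
      filter_upwards [hmem] with p hp
      obtain ⟨w, x⟩ := p
      simp only [Function.uncurry, norm_mul, norm_div, Real.norm_eq_abs]
      simp only at hp
      have hx : 0 < x := ha.trans_le hp.1
      rw [abs_of_pos hd, abs_of_pos hπ, abs_of_pos hx, abs_of_pos (two_pos (α := ℝ)),
        abs_of_pos (show 0 < w ^ 2 + (x / 2) ^ 2 by positivity)]
      have hc := Real.abs_cos_le_one (w * t)
      have h1 : x / 2 / (Real.pi * (w ^ 2 + (x / 2) ^ 2)) ≤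
          (a_M / 2 / Real.pi) * (w ^ 2 + (a_m / 2) ^ 2)⁻¹ := by
        rw [div_mul_eq_div_div, div_eq_mul_inv _ (w ^ 2 + (x / 2) ^ 2)]
        have haM0 : 0 < a_M := ha.trans haM
        gcongr
        · exact hp.2
        · exact hp.1
      calc |g x| / (a_M - a_m) * (|Real.cos (w * t)| * (x / 2 / (Real.pi * (w ^ 2 + (x / 2) ^ 2))))
          ≤ |g x| / (a_M - a_m) * (1 * ((a_M / 2 / Real.pi) * (w ^ 2 + (a_m / 2) ^ 2)⁻¹)) := by
            gcongr
        _ = _ := by ring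
  rw [integral_integral_swap hInt, intervalIntegral.integral_of_le haM.le,
    ← integral_Icc_eq_integral_Ioc, ← integral_div]
  refine setIntegral_congr_fun measurableSet_Icc fun x hx => ?_
  rw [integral_const_mul, integral_cos_mul_cauchy (half_pos (hsub hx))]
  ring

lemma integral_id_mul_exp_neg {τ : ℝ} (hτ : 0 < τ) (a b : ℝ) :
    ∫ x in a..b, x * Real.exp (-(x * τ)) =
      ((1 + a * τ) * Real.exp (-(a * τ)) - Real.exp (-(b * τ)) * (1 + b * τ)) / τ ^ 2 := by
  have hderiv (x : ℝ) : HasDerivAt (fun x => -((1 + x * τ) * Real.exp (-(x * τ)) / τ ^ 2))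
      (x * Real.exp (-(x * τ))) x := by
    have h1 : HasDerivAt (fun x => x * τ) τ x := by simpa using (hasDerivAt_id x).mul_const τ
    convert! (((h1.const_add 1).mul h1.neg.exp).div_const (τ ^ 2)).neg using 1
    simp only [Pi.neg_apply]
    field_simp
    ring
  rw [intervalIntegral.integral_eq_sub_of_hasDerivAt (fun x _ => hderiv x)
    (by exact Continuous.intervalIntegrable (by fun_prop) _ _)]
  ring

lemma integral_sq_mul_exp_neg {τ : ℝ} (hτ : 0 < τ) (a b : ℝ) :
    ∫ x in a..b, x ^ 2 * Real.exp (-(x * τ)) =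
      2 * ((1 + a * τ + a ^ 2 * τ ^ 2 / 2) * Real.exp (-(a * τ)) -
        Real.exp (-(b * τ)) * (1 + b * τ + b ^ 2 * τ ^ 2 / 2)) / τ ^ 3 := by
  have hderiv (x : ℝ) : HasDerivAt
      (fun x => -(2 * ((1 + x * τ + (x * τ) ^ 2 / 2) * Real.exp (-(x * τ))) / τ ^ 3))
      (x ^ 2 * Real.exp (-(x * τ))) x := by
    have h1 : HasDerivAt (fun x => x * τ) τ x := by simpa using (hasDerivAt_id x).mul_const τ
    convert! (((((h1.const_add 1).add ((h1.pow 2).div_const 2)).mul h1.neg.exp).const_mul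
      2).div_const (τ ^ 3)).neg using 1
    simp only [Pi.add_apply, Pi.pow_apply, Pi.neg_apply]
    field_simp
    ring
  rw [intervalIntegral.integral_eq_sub_of_hasDerivAt (fun x _ => hderiv x)
    (by exact Continuous.intervalIntegrable (by fun_prop) _ _)]
  ring

theorem muH_cauchyUniform (κ : ℝ) {a_m a_M : ℝ} (ha : 0 < a_m) (haM : a_m < a_M) {t : ℝ}
    (ht : 0 < t) :
    muH κ (cauchyUniform a_m a_M) t =
      -(r₁ κ / √2) *
        (((1 + a_m * t) * Real.exp (-(a_m * t)) - Real.exp (-(a_M * t)) * (1 + a_M * t)) /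
          (t ^ 2 * (a_M - a_m))) := by
  have h := integral_cos_mul_cauchyUniform ha haM
    (g := fun x => x * Real.exp (-(x * t / 2))) (by fun_prop) t
  rw [muH, h, div_mul_eq_div_div, ← integral_id_mul_exp_neg ht]
  congr 3
  ext x
  rw [mul_assoc, ← Real.exp_add, abs_of_pos ht]
  ring_nf

/-- The maximum appears because `(t + t')/2 + |t - t'|/2 = max t t'`: the first half comes from
damping, the second from the Cauchy average. -/
theorem limitKernel_cauchyUniform (κ : ℝ) {a_m a_M : ℝ} (ha : 0 < a_m) (haM : a_m < a_M)
    {t t' : ℝ} (hτ : 0 < max t t') :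
    limitKernel κ (cauchyUniform a_m a_M) t t' =
      1 / 2 * (2 * ((1 + a_m * max t t' + a_m ^ 2 * max t t' ^ 2 / 2) *
          Real.exp (-(a_m * max t t')) -
          Real.exp (-(a_M * max t t')) * (1 + a_M * max t t' + a_M ^ 2 * max t t' ^ 2 / 2)) /
          (max t t' ^ 3 * (a_M - a_m)))
        - muH κ (cauchyUniform a_m a_M) t * muH κ (cauchyUniform a_m a_M) t' := by
  have h := integral_cos_mul_cauchyUniform ha haM
    (g := fun x => x ^ 2 * Real.exp (-(x * (t + t') / 2))) (by fun_prop) (t - t')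
  rw [limitKernel, h, div_mul_eq_div_div, ← integral_sq_mul_exp_neg hτ]
  congr 4
  ext x
  have hmax : max t t' = (t + t' + |t - t'|) / 2 := by
    rcases le_total t t' with h | h
    · rw [max_eq_right h, abs_of_nonpos (sub_nonpos.2 h)]; ring
    · rw [max_eq_left h, abs_of_nonneg (sub_nonneg.2 h)]; ring
  rw [mul_assoc, ← Real.exp_add, hmax]
  ring_nf

end Cauchy

/-! ### Moments of the von Mises law. -/

section VonMises

open Real intervalIntegral

lemma integral_cos_pow_add_two (n : ℕ) :
    ∫ θ in -π..π, cos θ ^ (n + 2) = (n + 1) / (n + 2) * ∫ θ in -π..π, cos θ ^ n := by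
  rw [integral_cos_pow]; simp

lemma integral_cos_pow_odd (m : ℕ) : ∫ θ in -π..π, cos θ ^ (2 * m + 1) = 0 := by
  induction m with
  | zero => simp
  | succ m ih =>
    rw [show 2 * (m + 1) + 1 = 2 * m + 1 + 2 by ring, integral_cos_pow_add_two, ih, mul_zero]

lemma integral_cos_pow_even (m : ℕ) :
    ∫ θ in -π..π, cos θ ^ (2 * m) =
      2 * π * ((2 * m).factorial / (4 ^ m * (m.factorial : ℝ) ^ 2)) := by
  induction m with
  | zero => simp; ring
  | succ m ih =>
    rw [show 2 * (m + 1) = 2 * m + 2 by ring, integral_cos_pow_add_two, ih, Nat.factorial_succ m,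
      Nat.factorial_succ (2 * m + 1), Nat.factorial_succ (2 * m)]
    push_cast
    field_simp
    ring

/-- The integral representation `2π I₁(κ) = ∫ cos θ exp (κ cos θ) dθ` over a period. -/
lemma integral_cos_mul_exp_cos (κ : ℝ) :
    ∫ θ in -π..π, cos θ * exp (κ * cos θ) = 2 * π * besselI 1 κ := by
  have hsum : HasSum (fun n : ℕ => ∫ θ in -π..π, κ ^ n / n.factorial * cos θ ^ (n + 1))
      (∫ θ in -π..π, cos θ * exp (κ * cos θ)) := by
    refine intervalIntegral.hasSum_integral_of_dominated_convergence
      (bound := fun n _ => |κ| ^ n / n.factorial) ?_ ?_ ?_ ?_ ?_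
    · exact fun n => Continuous.aestronglyMeasurable (by fun_prop)
    · refine fun n => ae_of_all _ fun θ _ => ?_
      rw [norm_mul, norm_div, norm_pow, norm_pow, Real.norm_natCast,
        Real.norm_eq_abs, Real.norm_eq_abs]
      exact mul_le_of_le_one_right (by positivity) (pow_le_one₀ (abs_nonneg _) (abs_cos_le_one _))
    · exact ae_of_all _ fun θ _ => Real.summable_pow_div_factorial |κ|
    · exact intervalIntegrable_const
    · refine ae_of_all _ fun θ _ => ?_
      have h := (NormedSpace.expSeries_div_hasSum_exp (κ * cos θ)).mul_left (cos θ)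
      rw [← Real.exp_eq_exp_ℝ] at h
      refine h.congr_fun fun n => ?_
      simp only [mul_pow, pow_succ]
      ring
  -- The coefficient of `κ ^ n` involves `cos ^ (n + 1)`, whose integral vanishes for even `n`; the
  -- terms `n = 2m + 1` form the Bessel series.
  have hodd : HasSum (fun m : ℕ => 2 * π * ((κ / 2) ^ (2 * m + 1) /
      ((m.factorial : ℝ) * ((m + 1).factorial : ℝ)))) (∫ θ in -π..π, cos θ * exp (κ * cos θ)) := by
    have hinj : Function.Injective fun m : ℕ => 2 * m + 1 := fun a b h => by simpa using h
    rw [← hinj.hasSum_iff] at hsum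
    · refine hsum.congr_fun fun m => ?_
      simp only [Function.comp_apply, intervalIntegral.integral_const_mul]
      rw [show 2 * m + 1 + 1 = 2 * (m + 1) by ring, integral_cos_pow_even,
        show 2 * (m + 1) = 2 * m + 1 + 1 by ring, Nat.factorial_succ (2 * m + 1),
        Nat.factorial_succ m, div_pow, pow_succ 4, pow_succ 2, pow_mul 2]
      push_cast
      field_simp
      norm_num
      ring
    · intro n hn
      obtain ⟨m, rfl | rfl⟩ := n.even_or_odd'
      · rw [intervalIntegral.integral_const_mul, integral_cos_pow_odd, mul_zero]
      · exact absurd ⟨m, rfl⟩ hn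
  rw [besselI, ← tsum_mul_left, hodd.tsum_eq]

lemma besselI_nonneg {κ : ℝ} (hκ : 0 ≤ κ) (n : ℕ) : 0 ≤ besselI n κ :=
  tsum_nonneg fun m => by positivity

/-- The density of the angle under `vonMises diagDir κ`. -/
noncomputable def angleDensity (κ θ : ℝ) : ℝ := exp (κ * cos (θ - π / 4)) / (2 * π * besselI 0 κ)

@[fun_prop]
lemma continuous_angleDensity (κ : ℝ) : Continuous (angleDensity κ) := by
  unfold angleDensity; fun_prop

lemma cos_sub_pi_div_four (θ : ℝ) :
    1 / √2 * cos θ + 1 / √2 * sin θ = cos (θ - π / 4) := by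
  rw [cos_sub, cos_pi_div_four, sin_pi_div_four]
  have h : √2 * √2 = 2 := mul_self_sqrt (by norm_num)
  field_simp
  linear_combination -(cos θ + sin θ) * h

lemma integral_vonMises {κ : ℝ} (hκ : 0 ≤ κ) {h : ℝ × ℝ → ℝ} (hh : Continuous h) :
    ∫ s, h s ∂(vonMises diagDir κ) =
      ∫ θ in -π..π, angleDensity κ θ * h (cos θ, sin θ) := by
  rw [vonMises, integral_withDensity_eq_integral_toReal_smul (by fun_prop)
    (ae_of_all _ fun _ => ENNReal.ofReal_lt_top), integral_map (by fun_prop)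
    (by exact Measurable.aestronglyMeasurable (by fun_prop)),
    integral_of_le (by linarith [pi_pos])]
  refine integral_congr_ae (ae_of_all _ fun θ => ?_)
  have hI := besselI_nonneg hκ 0
  have hπ := pi_pos
  simp only [diagDir, cos_sub_pi_div_four, smul_eq_mul, angleDensity]
  rw [ENNReal.toReal_ofReal (by positivity)]

/-- The reflection `θ ↦ π/2 - θ` about the mean angle `π/4` preserves the density and exchanges sine
with cosine. Periodicity restores the interval. -/
lemma integral_angleDensity_mul_sin_pow (κ : ℝ) (n : ℕ) :
    ∫ θ in -π..π, angleDensity κ θ * sin θ ^ n =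
      ∫ θ in -π..π, angleDensity κ θ * cos θ ^ n := by
  let F : ℝ → ℝ := fun θ => angleDensity κ θ * cos θ ^ n
  have hper : Function.Periodic F (2 * π) := fun θ => by
    simp only [F, angleDensity, add_sub_right_comm, cos_add_two_pi]
  have h1 : ∀ θ, angleDensity κ θ * sin θ ^ n = F (π / 2 - θ) := fun θ => by
    simp only [F, angleDensity, cos_pi_div_two_sub]
    rw [← cos_neg (π / 2 - θ - π / 4)]
    ring_nf
  simp_rw [h1]
  rw [integral_comp_sub_left]
  have h2 := hper.intervalIntegral_add_eq (π / 2 - π) (-π)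
  rw [show π / 2 - π + 2 * π = π / 2 - -π by ring, show -π + 2 * π = π by ring] at h2
  exact h2

/-- The mean of the projection on the mean direction is `r₁ κ`; by the reflection symmetry both
coordinates contribute equally to it. -/
lemma integral_angleDensity_mul_cos (κ : ℝ) :
    ∫ θ in -π..π, angleDensity κ θ * cos θ = r₁ κ / √2 := by
  have hs := integral_angleDensity_mul_sin_pow κ 1
  simp only [pow_one] at hs
  have hadd : ∫ θ in -π..π, angleDensity κ θ * cos (θ - π / 4) =
      1 / √2 * (∫ θ in -π..π, angleDensity κ θ * cos θ) +
      1 / √2 * (∫ θ in -π..π, angleDensity κ θ * sin θ) := by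
    rw [← intervalIntegral.integral_const_mul, ← intervalIntegral.integral_const_mul,
      ← intervalIntegral.integral_add
      (by exact Continuous.intervalIntegrable (by fun_prop) _ _)
      (by exact Continuous.intervalIntegrable (by fun_prop) _ _)]
    refine integral_congr fun θ _ => ?_
    simp only [← cos_sub_pi_div_four θ]
    ring
  let F : ℝ → ℝ := fun θ => cos θ * exp (κ * cos θ) / (2 * π * besselI 0 κ)
  have hper : Function.Periodic F (2 * π) := fun θ => by simp only [F, cos_add_two_pi]
  have hF : ∫ θ in -π..π, angleDensity κ θ * cos (θ - π / 4) = r₁ κ := by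
    have h1 : ∀ θ, angleDensity κ θ * cos (θ - π / 4) = F (θ - π / 4) := fun θ => by
      simp only [F, angleDensity]; ring
    simp_rw [h1]
    rw [integral_comp_sub_right]
    have h2 := hper.intervalIntegral_add_eq (-π - π / 4) (-π)
    rw [show -π - π / 4 + 2 * π = π - π / 4 by ring, show -π + 2 * π = π by ring] at h2
    rw [h2, intervalIntegral.integral_div, integral_cos_mul_exp_cos, r₁,
      mul_div_mul_left _ _ (by positivity)]
  rw [hs, hF] at hadd
  have h : √2 * √2 = 2 := mul_self_sqrt (by norm_num)
  rw [hadd]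
  field_simp
  linear_combination (∫ θ in -π..π, angleDensity κ θ * cos θ) * h

lemma integral_fst_vonMises {κ : ℝ} (hκ : 0 ≤ κ) :
    ∫ s, s.1 ∂(vonMises diagDir κ) = r₁ κ / √2 := by
  rw [integral_vonMises hκ continuous_fst, integral_angleDensity_mul_cos]

lemma ae_vonMises (m : ℝ × ℝ) (κ : ℝ) : ∀ᵐ s ∂(vonMises m κ), s.1 ^ 2 + s.2 ^ 2 = 1 := by
  refine (withDensity_absolutelyContinuous _ _).ae_le ?_
  change ∀ᵐ s : ℝ × ℝ ∂_, s.1 ^ 2 + s.2 ^ 2 = 1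
  rw [ae_map_iff (by fun_prop) (measurableSet_eq_fun (by fun_prop) (by fun_prop))]
  exact ae_of_all _ fun θ => cos_sq_add_sin_sq θ

lemma integrable_vonMises {m : ℝ × ℝ} {κ : ℝ} [IsFiniteMeasure (vonMises m κ)]
    {h : ℝ × ℝ → ℝ} (hh : Continuous h) : Integrable h (vonMises m κ) := by
  obtain ⟨C, hC⟩ := ((isCompact_Icc (a := (-1 : ℝ)) (b := 1)).prod
    (isCompact_Icc (a := (-1 : ℝ)) (b := 1))).exists_bound_of_continuousOn hh.continuousOn
  refine Integrable.of_bound hh.aestronglyMeasurable C ?_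
  filter_upwards [ae_vonMises m κ] with s hs
  refine hC s ⟨?_, ?_⟩
  · exact abs_le.1 (abs_le_one_iff_mul_self_le_one.2 (by nlinarith [sq_nonneg s.2]))
  · exact abs_le.1 (abs_le_one_iff_mul_self_le_one.2 (by nlinarith [sq_nonneg s.1]))

lemma integral_snd_sq_vonMises {κ : ℝ} (hκ : 0 ≤ κ) :
    ∫ s, s.2 ^ 2 ∂(vonMises diagDir κ) = ∫ s, s.1 ^ 2 ∂(vonMises diagDir κ) := by
  rw [integral_vonMises hκ (h := fun s => s.2 ^ 2) (by fun_prop),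
    integral_vonMises hκ (h := fun s => s.1 ^ 2) (by fun_prop), integral_angleDensity_mul_sin_pow]

/-- The two second moments agree by symmetry and sum to `1` on the circle, so neither depends on
`κ`. -/
lemma integral_fst_sq_vonMises {κ : ℝ} (hκ : 0 ≤ κ) [IsProbabilityMeasure (vonMises diagDir κ)] :
    ∫ s, s.1 ^ 2 ∂(vonMises diagDir κ) = 1 / 2 := by
  have h1 : ∫ s, (s.1 ^ 2 + s.2 ^ 2) ∂(vonMises diagDir κ) = 1 := by
    rw [integral_congr_ae (ae_vonMises _ _)]
    simp
  rw [MeasureTheory.integral_add (integrable_vonMises (by fun_prop)) (integrable_vonMises (by fun_prop)),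
    integral_snd_sq_vonMises hκ] at h1
  linarith

end VonMises

/-! ### Integrability, mean and covariance of a single oscillator. -/

section Oscillator

lemma integral_paramLaw {φ : ℝ → ℝ → ℝ} (hφm : Measurable (Function.uncurry φ))
    (hφ : ∀ x ω, 0 < x → 0 ≤ φ x ω) {h : ℝ × ℝ → ℝ} (hh : Integrable h (paramLaw φ)) :
    ∫ p, h p ∂(paramLaw φ) = ∫ ω : ℝ, ∫ x in Set.Ioi (0 : ℝ), h (x, ω) * φ x ω := by
  have hm : Measurable fun p : ℝ × ℝ => ENNReal.ofReal (φ p.1 p.2) :=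
    ENNReal.measurable_ofReal.comp hφm
  have hvol : (volume : Measure (ℝ × ℝ)).restrict (Set.Ioi (0 : ℝ) ×ˢ (Set.univ : Set ℝ)) =
      (volume.restrict (Set.Ioi (0 : ℝ))).prod volume := by
    rw [Measure.volume_eq_prod, ← Measure.prod_restrict, Measure.restrict_univ]
  have hpos : ∀ᵐ p ∂((volume : Measure (ℝ × ℝ)).restrict
      (Set.Ioi (0 : ℝ) ×ˢ (Set.univ : Set ℝ))), (ENNReal.ofReal (φ p.1 p.2)).toReal • h p =
        h p * φ p.1 p.2 := by
    filter_upwards [ae_restrict_mem (measurableSet_Ioi.prod MeasurableSet.univ)] with p hp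
    rw [ENNReal.toReal_ofReal (hφ _ _ hp.1), smul_eq_mul, mul_comm]
  rw [paramLaw, integrable_withDensity_iff_integrable_smul' hm
    (ae_of_all _ fun _ => ENNReal.ofReal_lt_top), integrable_congr hpos, hvol] at hh
  rw [paramLaw, integral_withDensity_eq_integral_toReal_smul hm
    (ae_of_all _ fun _ => ENNReal.ofReal_lt_top), integral_congr_ae hpos, hvol,
    integral_prod_symm _ hh]

lemma integral_paramLaw_eq_zero_of_odd {φ : ℝ → ℝ → ℝ} (hφm : Measurable (Function.uncurry φ))
    (hφ : ∀ x ω, 0 < x → 0 ≤ φ x ω) (hφs : ∀ x ω, 0 < x → φ x (-ω) = φ x ω)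
    {h : ℝ × ℝ → ℝ} (hh : Integrable h (paramLaw φ)) (hodd : ∀ x ω, h (x, -ω) = -h (x, ω)) :
    ∫ p, h p ∂(paramLaw φ) = 0 := by
  rw [integral_paramLaw hφm hφ hh]
  have h1 : ∀ ω : ℝ, ∫ x in Set.Ioi (0 : ℝ), h (x, -ω) * φ x (-ω) =
      -∫ x in Set.Ioi (0 : ℝ), h (x, ω) * φ x ω := fun ω => by
    rw [← integral_neg]
    refine setIntegral_congr_fun measurableSet_Ioi fun x hx => ?_
    simp only [hodd, hφs x ω hx, neg_mul]
  have h2 := integral_neg_eq_self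
    (fun ω : ℝ => ∫ x in Set.Ioi (0 : ℝ), h (x, ω) * φ x ω) volume
  simp_rw [h1, integral_neg] at h2
  linarith

lemma ae_paramLaw_pos (φ : ℝ → ℝ → ℝ) : ∀ᵐ p ∂(paramLaw φ), 0 < p.1 := by
  refine (withDensity_absolutelyContinuous _ _).ae_le ?_
  filter_upwards [ae_restrict_mem (measurableSet_Ioi.prod MeasurableSet.univ)] with p hp
  exact hp.1

/-- The envelope `α² exp (-α² t / 2)`; the first coordinate of `p` stands for `α²`. -/
noncomputable def envelope (t : ℝ) (p : ℝ × ℝ) : ℝ := p.1 * Real.exp (-(p.1 * t / 2))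

/-- The impulse response at time `t` of one oscillator with parameters `((α², ω), s)`. -/
noncomputable def response (t : ℝ) (z : (ℝ × ℝ) × (ℝ × ℝ)) : ℝ :=
  envelope t z.1 * (-z.2.1 * Real.cos (z.1.2 * t) + z.2.2 * Real.sin (z.1.2 * t))

@[fun_prop]
lemma continuous_envelope (t : ℝ) : Continuous (envelope t) := by
  unfold envelope; fun_prop

lemma continuous_response (t : ℝ) : Continuous (response t) := by
  unfold response; fun_prop

/-- Boundedness by `2 / t` follows from `u ≤ exp u` at `u = xt/2`, so no moment of `α²` is needed.
-/
lemma memLp_envelope_of_pos (φ : ℝ → ℝ → ℝ) [IsFiniteMeasure (paramLaw φ)] {t : ℝ} (ht : 0 < t) :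
    MemLp (envelope t) 2 (paramLaw φ) := by
  refine MemLp.of_bound (continuous_envelope t).aestronglyMeasurable (2 / t) ?_
  filter_upwards [ae_paramLaw_pos φ] with p hp
  rw [envelope, Real.norm_eq_abs, abs_of_nonneg (by positivity), Real.exp_neg,
    ← div_eq_mul_inv, div_le_div_iff₀ (Real.exp_pos _) ht]
  linarith [Real.add_one_le_exp (p.1 * t / 2)]

lemma memLp_envelope_of_nonneg {φ : ℝ → ℝ → ℝ} (hφm : Measurable (Function.uncurry φ))
    (hφ : ∀ x ω, 0 < x → 0 ≤ φ x ω)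
    (hInt : IntegrableOn (fun p : ℝ × ℝ => p.1 ^ 2 * φ p.1 p.2) (Set.Ioi 0 ×ˢ Set.univ))
    {t : ℝ} (ht : 0 ≤ t) : MemLp (envelope t) 2 (paramLaw φ) := by
  have hm : Measurable fun p : ℝ × ℝ => ENNReal.ofReal (φ p.1 p.2) :=
    ENNReal.measurable_ofReal.comp hφm
  have hfst : MemLp (fun p : ℝ × ℝ => p.1) 2 (paramLaw φ) := by
    rw [memLp_two_iff_integrable_sq (by fun_prop), paramLaw,
      integrable_withDensity_iff_integrable_smul' hm
        (ae_of_all _ fun _ => ENNReal.ofReal_lt_top)]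
    refine Integrable.congr hInt ?_
    filter_upwards [ae_restrict_mem (measurableSet_Ioi.prod MeasurableSet.univ)] with p hp
    rw [ENNReal.toReal_ofReal (hφ _ _ hp.1), smul_eq_mul, mul_comm]
  refine hfst.mono (continuous_envelope t).aestronglyMeasurable ?_
  filter_upwards [ae_paramLaw_pos φ] with p hp
  rw [envelope, norm_mul, Real.norm_eq_abs (Real.exp _), Real.abs_exp]
  exact mul_le_of_le_one_right (norm_nonneg _)
    (Real.exp_le_one_iff.2 (by have := mul_nonneg hp.le ht; linarith))

lemma memLp_envelope_mul {φ : ℝ → ℝ → ℝ} {t : ℝ} (h : MemLp (envelope t) 2 (paramLaw φ))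
    {b : ℝ × ℝ → ℝ} (hb : Measurable b) (hb1 : ∀ p, |b p| ≤ 1) :
    MemLp (fun p => envelope t p * b p) 2 (paramLaw φ) := by
  refine h.mono ((continuous_envelope t).measurable.mul hb).aestronglyMeasurable
    (ae_of_all _ fun p => ?_)
  rw [norm_mul]
  exact mul_le_of_le_one_right (norm_nonneg _) (hb1 p)

lemma memLp_mul_prod_vonMises {μ : Measure (ℝ × ℝ)} {m : ℝ × ℝ} {κ : ℝ} [IsFiniteMeasure μ]
    [IsFiniteMeasure (vonMises m κ)] {u : ℝ × ℝ → ℝ} (hu : MemLp u 2 μ)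
    {b : ℝ × ℝ → ℝ} (hb : Continuous b) (hb1 : ∀ᵐ s ∂(vonMises m κ), |b s| ≤ 1) :
    MemLp (fun z : (ℝ × ℝ) × (ℝ × ℝ) => u z.1 * b z.2) 2 (μ.prod (vonMises m κ)) := by
  have hfst : MemLp (fun z : (ℝ × ℝ) × (ℝ × ℝ) => u z.1) 2 (μ.prod (vonMises m κ)) :=
    hu.comp_fst _
  refine hfst.mono (hfst.1.mul (hb.comp continuous_snd).aestronglyMeasurable) ?_
  filter_upwards [Measure.quasiMeasurePreserving_snd.ae hb1] with z hz
  rw [norm_mul]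
  exact mul_le_of_le_one_right (norm_nonneg _) hz

variable {κ : ℝ} {φ : ℝ → ℝ → ℝ}

lemma memLp_cos {t : ℝ} (h : MemLp (envelope t) 2 (paramLaw φ)) :
    MemLp (fun p => envelope t p * Real.cos (p.2 * t)) 2 (paramLaw φ) :=
  memLp_envelope_mul h (by fun_prop) fun _ => Real.abs_cos_le_one _

lemma memLp_sin {t : ℝ} (h : MemLp (envelope t) 2 (paramLaw φ)) :
    MemLp (fun p => envelope t p * Real.sin (p.2 * t)) 2 (paramLaw φ) :=
  memLp_envelope_mul h (by fun_prop) fun _ => Real.abs_sin_le_one _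

/-- Each term is now a function of `(α², ω)` times a function of `s`, as needed to factor integrals
over the product law. -/
lemma response_eq (t : ℝ) : response t = fun z =>
    envelope t z.1 * Real.cos (z.1.2 * t) * -z.2.1 +
      envelope t z.1 * Real.sin (z.1.2 * t) * z.2.2 := by
  ext z
  rw [response]
  ring

variable [IsProbabilityMeasure (paramLaw φ)] [IsProbabilityMeasure (vonMises diagDir κ)]

lemma memLp_response {t : ℝ} (h : MemLp (envelope t) 2 (paramLaw φ)) :
    MemLp (response t) 2 ((paramLaw φ).prod (vonMises diagDir κ)) := by
  rw [response_eq]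
  refine (memLp_mul_prod_vonMises (memLp_cos h) (b := fun s => -s.1) (by fun_prop) ?_).add
    (memLp_mul_prod_vonMises (memLp_sin h) (b := fun s => s.2) (by fun_prop) ?_)
  · filter_upwards [ae_vonMises diagDir κ] with s hs
    rw [abs_neg]
    exact abs_le_one_iff_mul_self_le_one.2 (by nlinarith [sq_nonneg s.2])
  · filter_upwards [ae_vonMises diagDir κ] with s hs
    exact abs_le_one_iff_mul_self_le_one.2 (by nlinarith [sq_nonneg s.1])

/-- The sine term is odd in `ω` and drops out, leaving only the mean of `s₁`. -/
lemma integral_response (hκ : 0 ≤ κ) (hφm : Measurable (Function.uncurry φ))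
    (hφ : ∀ x ω, 0 < x → 0 ≤ φ x ω) (hφs : ∀ x ω, 0 < x → φ x (-ω) = φ x ω)
    {t : ℝ} (h : MemLp (envelope t) 2 (paramLaw φ)) :
    ∫ z, response t z ∂((paramLaw φ).prod (vonMises diagDir κ)) = muH κ φ t := by
  have hc := (memLp_cos h).integrable (by norm_num)
  have hs := (memLp_sin h).integrable (by norm_num)
  have h1 : Integrable (fun s : ℝ × ℝ => -s.1) (vonMises diagDir κ) :=
    integrable_vonMises (by fun_prop)
  have h2 : Integrable (fun s : ℝ × ℝ => s.2) (vonMises diagDir κ) :=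
    integrable_vonMises (by fun_prop)
  rw [response_eq, integral_add (hc.mul_prod h1) (hs.mul_prod h2),
    integral_prod_mul (fun p : ℝ × ℝ => envelope t p * Real.cos (p.2 * t)) (fun s : ℝ × ℝ => -s.1),
    integral_prod_mul (fun p : ℝ × ℝ => envelope t p * Real.sin (p.2 * t)) (fun s : ℝ × ℝ => s.2),
    integral_paramLaw_eq_zero_of_odd hφm hφ hφs hs (fun x ω => by simp [envelope]),
    integral_neg, integral_fst_vonMises hκ, integral_paramLaw hφm hφ hc, muH]
  simp only [envelope]
  ring

lemma covariance_response (hκ : 0 ≤ κ) (hφm : Measurable (Function.uncurry φ))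
    (hφ : ∀ x ω, 0 < x → 0 ≤ φ x ω) (hφs : ∀ x ω, 0 < x → φ x (-ω) = φ x ω)
    {t t' : ℝ} (h : MemLp (envelope t) 2 (paramLaw φ))
    (h' : MemLp (envelope t') 2 (paramLaw φ)) :
    cov[response t, response t'; (paramLaw φ).prod (vonMises diagDir κ)] =
      limitKernel κ φ t t' := by
  rw [covariance_eq_sub (memLp_response h) (memLp_response h'),
    integral_response hκ hφm hφ hφs h, integral_response hκ hφm hφ hφs h', limitKernel]
  congr 1
  let A : ℝ × ℝ → ℝ := fun p =>
    (envelope t p * Real.cos (p.2 * t)) * (envelope t' p * Real.cos (p.2 * t'))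
  let B : ℝ × ℝ → ℝ := fun p =>
    (envelope t p * Real.sin (p.2 * t)) * (envelope t' p * Real.sin (p.2 * t'))
  -- The factor of the mixed moment of `s₁ s₂` is odd in `ω`, so that moment never has to be
  -- computed.
  let C : ℝ × ℝ → ℝ := fun p =>
    (envelope t p * Real.cos (p.2 * t)) * (envelope t' p * Real.sin (p.2 * t')) +
    (envelope t p * Real.sin (p.2 * t)) * (envelope t' p * Real.cos (p.2 * t'))
  have hA : Integrable A (paramLaw φ) := (memLp_cos h).integrable_mul (memLp_cos h')
  have hB : Integrable B (paramLaw φ) := (memLp_sin h).integrable_mul (memLp_sin h')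
  have hC : Integrable C (paramLaw φ) := ((memLp_cos h).integrable_mul (memLp_sin h')).add
    ((memLp_sin h).integrable_mul (memLp_cos h'))
  have h1 : Integrable (fun s : ℝ × ℝ => s.1 ^ 2) (vonMises diagDir κ) :=
    integrable_vonMises (by fun_prop)
  have h2 : Integrable (fun s : ℝ × ℝ => s.2 ^ 2) (vonMises diagDir κ) :=
    integrable_vonMises (by fun_prop)
  have h3 : Integrable (fun s : ℝ × ℝ => -(s.1 * s.2)) (vonMises diagDir κ) :=
    integrable_vonMises (by fun_prop)
  have hprod : response t * response t' = fun z =>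
      A z.1 * z.2.1 ^ 2 + B z.1 * z.2.2 ^ 2 + C z.1 * -(z.2.1 * z.2.2) := by
    ext z
    simp only [Pi.mul_apply, response, A, B, C]
    ring
  have hAB : Integrable (fun z : (ℝ × ℝ) × (ℝ × ℝ) => A z.1 * z.2.1 ^ 2 + B z.1 * z.2.2 ^ 2)
      ((paramLaw φ).prod (vonMises diagDir κ)) := (hA.mul_prod h1).add (hB.mul_prod h2)
  rw [hprod, integral_add hAB (hC.mul_prod h3),
    integral_add (hA.mul_prod h1) (hB.mul_prod h2),
    integral_prod_mul A (fun s : ℝ × ℝ => s.1 ^ 2), integral_prod_mul B (fun s : ℝ × ℝ => s.2 ^ 2),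
    integral_prod_mul C (fun s : ℝ × ℝ => -(s.1 * s.2)),
    integral_paramLaw_eq_zero_of_odd hφm hφ hφs hC
      (fun x ω => by simp only [C, envelope, neg_mul, Real.cos_neg, Real.sin_neg]; ring),
    integral_snd_sq_vonMises hκ, integral_fst_sq_vonMises hκ, zero_mul, add_zero, ← add_mul,
    ← integral_add hA hB, mul_comm, integral_paramLaw hφm hφ (h := fun p => A p + B p) (hA.add hB)]
  congr 1
  refine integral_congr_ae (ae_of_all _ fun ω => ?_)
  refine integral_congr_ae (ae_of_all _ fun x => ?_)
  simp only [A, B, envelope]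
  rw [mul_sub, Real.cos_sub,
    show -(x * (t + t') / 2) = -(x * t / 2) + -(x * t' / 2) by ring, Real.exp_add]
  ring

end Oscillator

end QWiener

theorem mainTheorem3 {Ω : Type*} [MeasurableSpace Ω] (P : Measure Ω) [IsProbabilityMeasure P]
    (κ : ℝ) (hκ : 0 < κ)
    (φ : ℝ → ℝ → ℝ) (hφ_meas : Measurable (Function.uncurry φ))
    (hφ_nonneg : ∀ x ω, 0 < x → 0 ≤ φ x ω)
    (hφ_symm : ∀ x ω, 0 < x → φ x (-ω) = φ x ω)
    (α w : ℕ → Ω → ℝ) (s : ℕ → Ω → ℝ × ℝ)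
    (h_param : ∀ i, HasLaw (fun o => ((α i o) ^ 2, w i o)) (QWiener.paramLaw φ) P)
    (h_vm : ∀ i, HasLaw (s i) (QWiener.vonMises QWiener.diagDir κ) P)
    (h_indep : ∀ i, IndepFun (fun o => ((α i o) ^ 2, w i o)) (s i) P)
    (h_iIndep : iIndepFun (fun i o => (((α i o) ^ 2, w i o), s i o)) P) :
    QWiener.ConvergesToGP P (Set.Ioi 0)
      (fun n t o => √(n : ℝ) *
        (QWiener.impulseResponse n (fun i => α i o) (fun i => w i o) (fun i => s i o) t / n
          - QWiener.muH κ φ t))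
      (QWiener.limitKernel κ φ) ∧
    (IntegrableOn (fun p : ℝ × ℝ => p.1 ^ 2 * φ p.1 p.2) (Set.Ioi 0 ×ˢ Set.univ) →
      QWiener.ConvergesToGP P (Set.Ici 0)
        (fun n t o => √(n : ℝ) *
          (QWiener.impulseResponse n (fun i => α i o) (fun i => w i o) (fun i => s i o) t / n
            - QWiener.muH κ φ t))
        (QWiener.limitKernel κ φ)) ∧
    ∀ a_m a_M : ℝ, 0 < a_m → a_m < a_M →
      (∀ t : ℝ, 0 < t →
        QWiener.muH κ (QWiener.cauchyUniform a_m a_M) t =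
          -(QWiener.r₁ κ / √2) *
            (((1 + a_m * t) * Real.exp (-(a_m * t)) - Real.exp (-(a_M * t)) * (1 + a_M * t)) /
              (t ^ 2 * (a_M - a_m)))) ∧
      (∀ t t' τ : ℝ, 0 ≤ t → 0 ≤ t' → τ = max t t' → 0 < τ →
        QWiener.limitKernel κ (QWiener.cauchyUniform a_m a_M) t t' =
          1 / 2 * (2 * ((1 + a_m * τ + a_m ^ 2 * τ ^ 2 / 2) * Real.exp (-(a_m * τ)) -
              Real.exp (-(a_M * τ)) * (1 + a_M * τ + a_M ^ 2 * τ ^ 2 / 2)) /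
              (τ ^ 3 * (a_M - a_m)))
            - QWiener.muH κ (QWiener.cauchyUniform a_m a_M) t *
              QWiener.muH κ (QWiener.cauchyUniform a_m a_M) t') := by
  -- Normalisation of `φ` and of the von Mises density is inherited from `P` through the laws.
  have : IsProbabilityMeasure (QWiener.paramLaw φ) := (h_param 0).isProbabilityMeasure_iff.1 ‹_›
  have : IsProbabilityMeasure (QWiener.vonMises QWiener.diagDir κ) :=
    (h_vm 0).isProbabilityMeasure_iff.1 ‹_›
  have hlaw (i : ℕ) : HasLaw (fun o => (((α i o) ^ 2, w i o), s i o))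
      ((QWiener.paramLaw φ).prod (QWiener.vonMises QWiener.diagDir κ)) P :=
    ⟨(h_param i).aemeasurable.prodMk (h_vm i).aemeasurable, by
      rw [(indepFun_iff_map_prod_eq_prod_map_map (h_param i).aemeasurable
        (h_vm i).aemeasurable).1 (h_indep i), (h_param i).map_eq, (h_vm i).map_eq]⟩
  have key (T : Set ℝ) (hT : ∀ t ∈ T, MemLp (QWiener.envelope t) 2 (QWiener.paramLaw φ)) :=
    QWiener.convergesToGP_of_iid hlaw h_iIndep (T := T) (f := QWiener.response)
      (fun t => (QWiener.continuous_response t).measurable)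
      (fun t ht => QWiener.memLp_response (hT t ht))
      (fun t ht => QWiener.integral_response hκ.le hφ_meas hφ_nonneg hφ_symm (hT t ht))
      (fun t ht t' ht' =>
        QWiener.covariance_response hκ.le hφ_meas hφ_nonneg hφ_symm (hT t ht) (hT t' ht'))
  refine ⟨key _ fun t ht => QWiener.memLp_envelope_of_pos φ ht,
    fun hInt => key _ fun t ht => QWiener.memLp_envelope_of_nonneg hφ_meas hφ_nonneg hInt ht,
    fun a_m a_M ha haM => ⟨fun t ht => QWiener.muH_cauchyUniform κ ha haM ht, ?_⟩⟩
  rintro t t' τ - - rfl hτ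
  exact QWiener.limitKernel_cauchyUniform κ ha haM hτ
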